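/- Theorem 5.1. Let $\Gamma=(V,E)$ be a simple graph (undirected, without loops or multiple edges; not assumed finite) and let $(M_\alpha)_{\alpha\in V}$ be a family of mutually disjoint monoids, $1_\alpha$ being the identity of $M_\alpha$. Let $\mathscr{GP}=\mathscr{GP}(\Gamma,(M_\alpha)_{\alpha\in V})$ be their graph product, that is, the monoid given by the presentation $\langle X\mid R\rangle$, where $X=\bigcup_{\alpha\in V}M_\alpha$ and, writing $\circ$ for concatenation of words over $X$ and $\epsilon$ for the empty word, $R$ consists of the relations $$1_\alpha=\epsilon\ (\alpha\in V),\qquad x\circ y=xy\ (\alpha\in V,\ x,y\in M_\alpha),\qquad x\circ y=y\circ x\ ((\alpha,\beta)\in E,\ x\in M_\alpha,\ y\in M_\beta).$$ A left ideal of a monoid $M$ is a subset $I\subseteq M$, possibly empty, with $MI\subseteq I$; it is finitely generated if $I=MY$ for some finite (possibly empty) set $Y\subseteq M$. A monoid is called left ideal Howson if the intersection of any two finitely generated left ideals (equivalently, of any two principal left ideals $Ma$ and $Mb$) is finitely generated. Then $\mathscr{GP}$ is left ideal Howson if and only if $M_\alpha$ is left ideal Howson for every $\alpha\in V$. -/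

import Mathlib

universe u v

/-- The defining relations of the graph product of a family of monoids `M α`, indexed by the
vertices `α` of a simple graph `Γ`, on words over the disjoint union of the vertex monoids. -/
inductive GraphProduct.Rel {V : Type u} (Γ : SimpleGraph V) (M : V → Type v)
    [∀ α, Monoid (M α)] : FreeMonoid (Σ α, M α) → FreeMonoid (Σ α, M α) → Prop
  /-- The identity of each vertex monoid is the empty word. -/
  | one (α : V) : GraphProduct.Rel Γ M (FreeMonoid.of ⟨α, 1⟩) 1
  /-- Products inside one vertex monoid are computed in that monoid. -/
  | mul {α : V} (x y : M α) : GraphProduct.Rel Γ M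
      (FreeMonoid.of ⟨α, x⟩ * FreeMonoid.of ⟨α, y⟩) (FreeMonoid.of ⟨α, x * y⟩)
  /-- Elements of adjacent vertex monoids commute. -/
  | comm {α β : V} (h : Γ.Adj α β) (x : M α) (y : M β) : GraphProduct.Rel Γ M
      (FreeMonoid.of ⟨α, x⟩ * FreeMonoid.of ⟨β, y⟩)
      (FreeMonoid.of ⟨β, y⟩ * FreeMonoid.of ⟨α, x⟩)

/-- The graph product of the monoids `M α` with respect to the simple graph `Γ`: the monoid
presented by the generators `Σ α, M α` and the relations `GraphProduct.Rel Γ M`. -/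
abbrev GraphProduct {V : Type u} (Γ : SimpleGraph V) (M : V → Type v)
    [∀ α, Monoid (M α)] : Type (max u v) :=
  PresentedMonoid (GraphProduct.Rel Γ M)

/-- A monoid is left ideal Howson if the intersection of any two finitely generated left ideals
is finitely generated. In Mathlib a `SemigroupIdeal` is a left ideal: a subset, possibly empty,
closed under multiplication on the left by all elements. The empty one is generated by `∅`. -/
def IsLeftIdealHowson (M : Type u) [Monoid M] : Prop :=
  ∀ I J : SemigroupIdeal M, I.FG → J.FG → (I ⊓ J).FG

/-- Equivalently, the intersection `M a ∩ M b` of any two principal left ideals is finitely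
generated, i.e. of the form `M X` for a finite set `X`. -/
theorem isLeftIdealHowson_iff_principal (M : Type u) [Monoid M] :
    IsLeftIdealHowson M ↔ ∀ a b : M, ∃ X : Set M, X.Finite ∧
      {z | (∃ s, z = s * a) ∧ (∃ t, z = t * b)} = {z | ∃ s, ∃ x ∈ X, z = s * x} := by
  have hcl : ∀ (s : Set M) (z : M), z ∈ SemigroupIdeal.closure s ↔ ∃ r, ∃ x ∈ s, z = r * x := by
    intro s z
    simp only [SemigroupIdeal.mem_closure'', eq_comm]
  have hinf : ∀ (I J : SemigroupIdeal M) (z : M), z ∈ I ⊓ J ↔ z ∈ I ∧ z ∈ J :=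
    fun _ _ _ => Iff.rfl
  constructor
  · intro h a b
    obtain ⟨X, hX, he⟩ := h (SemigroupIdeal.closure {a}) (SemigroupIdeal.closure {b})
      ⟨{a}, Set.finite_singleton a, rfl⟩ ⟨{b}, Set.finite_singleton b, rfl⟩
    refine ⟨X, hX, Set.ext fun z => ?_⟩
    have := (SetLike.ext_iff.mp he z)
    rw [hinf, hcl, hcl, hcl] at this
    simpa using this
  · rintro h I J ⟨A, hA, rfl⟩ ⟨B, hB, rfl⟩
    choose X hX he using h
    refine ⟨⋃ a ∈ A, ⋃ b ∈ B, X a b,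
      hA.biUnion fun a _ => hB.biUnion fun b _ => hX a b, SetLike.ext fun z => ?_⟩
    rw [hinf, hcl, hcl, hcl]
    constructor
    · rintro ⟨⟨s, a, ha, h1⟩, t, b, hb, h2⟩
      obtain ⟨r, x, hx, h3⟩ := (Set.ext_iff.mp (he a b) z).mp ⟨⟨s, h1⟩, t, h2⟩
      exact ⟨r, x, by simp only [Set.mem_iUnion]; exact ⟨a, ha, b, hb, hx⟩, h3⟩
    · rintro ⟨r, x, hx, h3⟩
      simp only [Set.mem_iUnion] at hx
      obtain ⟨a, ha, b, hb, hx⟩ := hx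
      obtain ⟨⟨s, h1⟩, t, h2⟩ := (Set.ext_iff.mp (he a b) z).mpr ⟨r, x, hx, h3⟩
      exact ⟨⟨s, a, ha, h1⟩, t, b, hb, h2⟩

/-!
A word over the vertex monoids is reduced if no letter is trivial and no two letters of the same
vertex can be brought together by exchanging neighbouring letters of adjacent vertices. Letting the
graph product act on reduced words up to such exchanges shows that each of its elements has exactly
one reduced word up to exchanges. Hence every `g` factors uniquely as `stem α g * of α (tail α g)`
where no nontrivial letter of `M α` can be moved to the end of `stem α g`. This is all that is used
about normal forms, in the shape of three facts: right multiplication by `M α` changes only the tail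
(`tail_mul_of`, `stem_mul_of`), right multiplication by a vertex adjacent to `α` leaves the tail
alone (`tail_mul_of_adj`), and two distinct non-adjacent vertices cannot both have a nontrivial
tail (`tail_eq_one_or`).

The left ideal generated by `a` can interact with the final letters of `a` in two ways only
(`rigid_or_star`). Either `a = u * of α m` where *no* left multiple of `u` has a nontrivial `α`-tail,
so that all elements of the left ideal end in the same `m`; or, after cancelling left invertible
letters at the front, `a` generates the same left ideal as some `c * of α k` with all letters of `c`
adjacent to `α`, so that the `α`-tails of the left ideal are the elements of `M α * k`.

The intersection of the left ideals of `a` and `b` is then treated by induction on the length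
of `a` (`finitelyIntersecting`): take the last letter of `a`, of vertex `α` say, and write
`a`, `b` as above with stems `u`, `v`. A common left multiple is determined by its stem, a common
left multiple of `u` and `v`, and its tail, which is a fixed element unless both elements are of the
second kind; in that case it is an arbitrary common left multiple in `M α`, and this is where the
hypothesis on `M α` is used. In order that the generators for `u` and `v` commute with `M α` in this
case, the induction also records that generators can be found among the products of letters whose
vertices occur in `a` or `b`.

Conversely, `M α` is a retract of the graph product, and the property passes to retracts.
-/

namespace GraphProduct

variable {V : Type u} {Γ : SimpleGraph V} {M : V → Type v}

/-! ### Words and their final letters -/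

/-- Equality of words up to exchanging neighbouring letters of adjacent vertices. -/
inductive Shuffle (Γ : SimpleGraph V) : List (Σ α, M α) → List (Σ α, M α) → Prop
  | nil : Shuffle Γ [] []
  | cons (x : Σ α, M α) {w w' : List (Σ α, M α)} : Shuffle Γ w w' → Shuffle Γ (x :: w) (x :: w')
  | swap {x y : Σ α, M α} (h : Γ.Adj x.1 y.1) (w : List (Σ α, M α)) :
      Shuffle Γ (x :: y :: w) (y :: x :: w)
  | trans {w w' w'' : List (Σ α, M α)} : Shuffle Γ w w' → Shuffle Γ w' w'' → Shuffle Γ w w''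

theorem Shuffle.refl : ∀ w : List (Σ α, M α), Shuffle Γ w w
  | [] => .nil
  | x :: w => .cons x (Shuffle.refl w)

theorem Shuffle.symm {w w' : List (Σ α, M α)} (h : Shuffle Γ w w') : Shuffle Γ w' w := by
  induction h with
  | nil => exact .nil
  | cons x _ ih => exact .cons x ih
  | swap h w => exact .swap h.symm w
  | trans _ _ ih₁ ih₂ => exact ih₂.trans ih₁

variable [∀ α, Monoid (M α)]

open Classical in
/-- Words are stored in reverse, so that the head of the list is the last letter. `split Γ α w`
is the letter of vertex `α` that can be moved to the end of `w`, or `1` if there is none,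
together with the remaining word. -/
noncomputable def split (Γ : SimpleGraph V) (α : V) :
    List (Σ β, M β) → M α × List (Σ β, M β)
  | [] => (1, [])
  | ⟨β, x⟩ :: w =>
    if h : β = α then (h ▸ x, w)
    else if Γ.Adj α β then ((split Γ α w).1, ⟨β, x⟩ :: (split Γ α w).2)
    else (1, ⟨β, x⟩ :: w)

@[simp] theorem split_cons_self (α : V) (x : M α) (w : List (Σ β, M β)) :
    split Γ α (⟨α, x⟩ :: w) = (x, w) := by
  simp [split]

theorem split_cons_adj {α β : V} (h : Γ.Adj α β) (x : M β) (w : List (Σ β, M β)) :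
    split Γ α (⟨β, x⟩ :: w) = ((split Γ α w).1, ⟨β, x⟩ :: (split Γ α w).2) := by
  simp [split, h, h.ne']

theorem split_cons_not_adj {α β : V} (hne : β ≠ α) (h : ¬ Γ.Adj α β) (x : M β)
    (w : List (Σ β, M β)) : split Γ α (⟨β, x⟩ :: w) = (1, ⟨β, x⟩ :: w) := by
  simp [split, h, hne]

/-- A vertex is equal to `α`, adjacent to `α`, or neither. -/
theorem eq_or_adj_or (Γ : SimpleGraph V) (α β : V) :
    β = α ∨ Γ.Adj α β ∨ (β ≠ α ∧ ¬ Γ.Adj α β) := by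
  tauto

theorem split_shuffle (α : V) {w w' : List (Σ β, M β)} (h : Shuffle Γ w w') :
    (split Γ α w).1 = (split Γ α w').1 ∧ Shuffle Γ (split Γ α w).2 (split Γ α w').2 := by
  induction h with
  | nil => exact ⟨rfl, .nil⟩
  | cons x h ih =>
    obtain ⟨β, x⟩ := x
    rcases eq_or_adj_or Γ α β with rfl | hβ | ⟨hne, hβ⟩
    · simpa using h
    · simpa [split_cons_adj hβ] using ⟨ih.1, ih.2.cons _⟩
    · simpa [split_cons_not_adj hne hβ] using h.cons _
  | @swap x y hxy w =>
    obtain ⟨β, x⟩ := x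
    obtain ⟨γ, y⟩ := y
    rcases eq_or_adj_or Γ α β with rfl | hβ | ⟨hne, hβ⟩
    · simpa [split_cons_adj hxy] using Shuffle.refl _
    · rcases eq_or_adj_or Γ α γ with rfl | hγ | ⟨hne', hγ⟩
      · simpa [split_cons_adj hβ] using Shuffle.refl _
      · simpa [split_cons_adj hβ, split_cons_adj hγ] using Shuffle.swap hxy _
      · simpa [split_cons_adj hβ, split_cons_not_adj hne' hγ] using Shuffle.swap hxy _
    · rcases eq_or_adj_or Γ α γ with rfl | hγ | ⟨hne', hγ⟩
      · exact absurd hxy.symm hβ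
      · simpa [split_cons_adj hγ, split_cons_not_adj hne hβ] using Shuffle.swap hxy _
      · simpa [split_cons_not_adj hne' hγ, split_cons_not_adj hne hβ] using Shuffle.swap hxy _
  | trans _ _ ih₁ ih₂ => exact ⟨ih₁.1.trans ih₂.1, ih₁.2.trans ih₂.2⟩

/-- The order in which letters of two adjacent vertices are split off does not matter. -/
theorem split_split {α β : V} (h : Γ.Adj α β) (w : List (Σ γ, M γ)) :
    (split Γ β (split Γ α w).2).1 = (split Γ β w).1 ∧
      (split Γ β (split Γ α w).2).2 = (split Γ α (split Γ β w).2).2 := by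
  induction w with
  | nil => exact ⟨rfl, rfl⟩
  | cons x w ih =>
    obtain ⟨γ, x⟩ := x
    rcases eq_or_adj_or Γ α γ with rfl | hα | ⟨hne, hα⟩
    · simp [split_cons_adj h.symm]
    · rcases eq_or_adj_or Γ β γ with rfl | hβ | ⟨hne', hβ⟩
      · simp [split_cons_adj hα]
      · simp [split_cons_adj hα, split_cons_adj hβ, ih]
      · simp [split_cons_adj hα, split_cons_not_adj hne' hβ]
    · rcases eq_or_adj_or Γ β γ with rfl | hβ | ⟨hne', hβ⟩
      · exact absurd h hα
      · simp [split_cons_adj hβ, split_cons_not_adj hne hα]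
      · simp [split_cons_not_adj hne hα, split_cons_not_adj hne' hβ]

/-! ### Reduced words -/

/-- A word is reduced if it has no trivial letters and no letter can be moved next to an earlier
letter of the same vertex. -/
def Reduced (Γ : SimpleGraph V) : List (Σ α, M α) → Prop
  | [] => True
  | x :: w => x.2 ≠ 1 ∧ (split Γ x.1 w).1 = 1 ∧ Reduced Γ w

theorem Reduced.split_eq {α : V} {w : List (Σ α, M α)} (hw : Reduced Γ w)
    (h : (split Γ α w).1 = 1) : split Γ α w = (1, w) := by
  induction w with
  | nil => rfl
  | cons x w ih =>
    obtain ⟨β, x⟩ := x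
    rcases eq_or_adj_or Γ α β with rfl | hβ | ⟨hne, hβ⟩
    · exact absurd (by simpa using h) hw.1
    · rw [split_cons_adj hβ] at h ⊢
      rw [ih hw.2.2 h]
    · rw [split_cons_not_adj hne hβ]

theorem Reduced.split {w : List (Σ α, M α)} (hw : Reduced Γ w) (α : V) :
    Reduced Γ (split Γ α w).2 ∧
      GraphProduct.split Γ α (GraphProduct.split Γ α w).2 =
        (1, (GraphProduct.split Γ α w).2) := by
  induction w with
  | nil => exact ⟨trivial, rfl⟩
  | cons x w ih =>
    obtain ⟨β, x⟩ := x
    rcases eq_or_adj_or Γ α β with rfl | hβ | ⟨hne, hβ⟩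
    · simpa using ⟨hw.2.2, hw.2.2.split_eq hw.2.1⟩
    · simp only [split_cons_adj hβ]
      obtain ⟨h₁, h₂⟩ := ih hw.2.2
      exact ⟨⟨hw.1, (split_split hβ w).1.trans hw.2.1, h₁⟩, by rw [h₂]⟩
    · simpa [split_cons_not_adj hne hβ] using hw

/-- Of two distinct non-adjacent vertices, at most one contributes a letter at the end. -/
theorem Reduced.split_eq_one_or {w : List (Σ α, M α)} (hw : Reduced Γ w) {α β : V} (hne : β ≠ α)
    (h : ¬ Γ.Adj α β) : (GraphProduct.split Γ α w).1 = 1 ∨ (GraphProduct.split Γ β w).1 = 1 := by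
  induction w with
  | nil => exact .inl rfl
  | cons x w ih =>
    obtain ⟨γ, x⟩ := x
    rcases eq_or_adj_or Γ α γ with rfl | hα | ⟨hne₁, hα⟩
    · right
      rw [split_cons_not_adj hne.symm fun h' => h h'.symm]
    · rcases eq_or_adj_or Γ β γ with rfl | hβ | ⟨hne₂, hβ⟩
      · exact absurd hα h
      · simpa [split_cons_adj hα, split_cons_adj hβ] using ih hw.2.2
      · right
        rw [split_cons_not_adj hne₂ hβ]
    · left
      rw [split_cons_not_adj hne₁ hα]

open Classical in
/-- Append the letter `x` of vertex `α` to a word, unless it is trivial. -/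
noncomputable def consNe (α : V) (x : M α) (w : List (Σ α, M α)) : List (Σ α, M α) :=
  if x = 1 then w else ⟨α, x⟩ :: w

theorem consNe_one (α : V) (w : List (Σ α, M α)) : consNe α 1 w = w := by
  simp [consNe]

theorem consNe_of_ne {α : V} {x : M α} (hx : x ≠ 1) (w : List (Σ α, M α)) :
    consNe α x w = ⟨α, x⟩ :: w := by
  simp [consNe, hx]

theorem Shuffle.consNe {w w' : List (Σ α, M α)} (h : Shuffle Γ w w') (α : V) (x : M α) :
    Shuffle Γ (consNe α x w) (consNe α x w') := by
  by_cases hx : x = 1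
  · simpa [hx, consNe_one] using h
  · simpa [consNe_of_ne hx] using h.cons _

theorem shuffle_consNe_comm {α β : V} (h : Γ.Adj α β) (x : M α) (y : M β)
    (w : List (Σ α, M α)) :
    Shuffle Γ (consNe α x (consNe β y w)) (consNe β y (consNe α x w)) := by
  by_cases hx : x = 1
  · simpa [hx, consNe_one] using Shuffle.refl _
  · by_cases hy : y = 1
    · simpa [hy, consNe_one] using Shuffle.refl _
    · simpa [consNe_of_ne hx, consNe_of_ne hy] using Shuffle.swap h w

theorem split_consNe_self {α : V} {w : List (Σ α, M α)} (h : split Γ α w = (1, w)) (x : M α) :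
    split Γ α (consNe α x w) = (x, w) := by
  by_cases hx : x = 1
  · simp [hx, consNe_one, h]
  · simp [consNe_of_ne hx]

theorem split_consNe_adj {α β : V} (h : Γ.Adj α β) (y : M β) (w : List (Σ α, M α)) :
    split Γ α (consNe β y w) = ((split Γ α w).1, consNe β y (split Γ α w).2) := by
  by_cases hy : y = 1
  · simp [hy, consNe_one]
  · simp [consNe_of_ne hy, split_cons_adj h]

theorem Reduced.consNe {α : V} {w : List (Σ α, M α)} (hw : Reduced Γ w)
    (h : (GraphProduct.split Γ α w).1 = 1) (x : M α) : Reduced Γ (consNe α x w) := by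
  by_cases hx : x = 1
  · simpa [hx, consNe_one] using hw
  · rw [consNe_of_ne hx]
    exact ⟨hx, h, hw⟩

theorem Reduced.shuffle_consNe_split {w : List (Σ α, M α)} (hw : Reduced Γ w) (α : V) :
    Shuffle Γ (GraphProduct.consNe α (GraphProduct.split Γ α w).1 (GraphProduct.split Γ α w).2)
      w := by
  induction w with
  | nil => simpa [GraphProduct.split, consNe_one] using Shuffle.nil
  | cons x w ih =>
    obtain ⟨β, x⟩ := x
    rcases eq_or_adj_or Γ α β with rfl | hβ | ⟨hne, hβ⟩
    · rw [split_cons_self, consNe_of_ne hw.1]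
      exact Shuffle.refl _
    · rw [split_cons_adj hβ, ← consNe_of_ne hw.1, ← consNe_of_ne hw.1]
      exact (shuffle_consNe_comm hβ _ _ _).trans ((ih hw.2.2).consNe _ _)
    · rw [split_cons_not_adj hne hβ, consNe_one]
      exact Shuffle.refl _

/-- Right multiplication of a reduced word by an element of a vertex monoid. -/
noncomputable def push (Γ : SimpleGraph V) (α : V) (x : M α) (w : List (Σ α, M α)) :
    List (Σ α, M α) :=
  consNe α ((split Γ α w).1 * x) (split Γ α w).2

theorem Reduced.push {w : List (Σ α, M α)} (hw : Reduced Γ w) (α : V) (x : M α) :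
    Reduced Γ (push Γ α x w) :=
  (hw.split α).1.consNe (by rw [(hw.split α).2]) _

theorem Reduced.split_push {w : List (Σ α, M α)} (hw : Reduced Γ w) (α : V) (x : M α) :
    GraphProduct.split Γ α (GraphProduct.push Γ α x w) =
      ((GraphProduct.split Γ α w).1 * x, (GraphProduct.split Γ α w).2) :=
  split_consNe_self (hw.split α).2 _

theorem Shuffle.push {w w' : List (Σ α, M α)} (h : Shuffle Γ w w') (α : V) (x : M α) :
    Shuffle Γ (push Γ α x w) (push Γ α x w') := by
  unfold GraphProduct.push
  rw [(split_shuffle α h).1]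
  exact (split_shuffle α h).2.consNe _ _

theorem Reduced.push_push {w : List (Σ α, M α)} (hw : Reduced Γ w) (α : V) (x y : M α) :
    GraphProduct.push Γ α y (GraphProduct.push Γ α x w) = GraphProduct.push Γ α (x * y) w := by
  rw [GraphProduct.push, hw.split_push, GraphProduct.push, mul_assoc]

theorem shuffle_push_comm {α β : V} (h : Γ.Adj α β) (x : M α) (y : M β)
    (w : List (Σ α, M α)) :
    Shuffle Γ (push Γ β y (push Γ α x w)) (push Γ α x (push Γ β y w)) := by
  simp only [push, split_consNe_adj h, split_consNe_adj h.symm, (split_split h w).1,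
    (split_split h w).2, (split_split h.symm w).1]
  exact shuffle_consNe_comm h.symm _ _ _

/-! ### Uniqueness of reduced words -/

/-- The embedding of a vertex monoid into the graph product. -/
def of (Γ : SimpleGraph V) (α : V) : M α →* GraphProduct Γ M where
  toFun x := PresentedMonoid.of (Rel Γ M) ⟨α, x⟩
  map_one' := PresentedMonoid.mk_eq_mk_of_rel (Rel.one α)
  map_mul' x y := (PresentedMonoid.mk_eq_mk_of_rel (Rel.mul x y)).symm

theorem of_comm {α β : V} (h : Γ.Adj α β) (x : M α) (y : M β) :
    of Γ α x * of Γ β y = of Γ β y * of Γ α x :=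
  PresentedMonoid.mk_eq_mk_of_rel (Rel.comm h x y)

theorem induction_on {p : GraphProduct Γ M → Prop} (g : GraphProduct Γ M) (one : p 1)
    (mul_of : ∀ g (α : V) (x : M α), p g → p (g * of Γ α x)) : p g := by
  induction g using PresentedMonoid.inductionOn with
  | _ w =>
    induction w using List.reverseRecOn with
    | nil => exact one
    | append_singleton w x ih => exact mul_of _ x.1 x.2 ih

/-- Reduced words up to shuffles. -/
def shuffleSetoid (Γ : SimpleGraph V) (M : V → Type v) [∀ α, Monoid (M α)] :
    Setoid {w : List (Σ α, M α) // Reduced Γ w} where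
  r w w' := Shuffle Γ w.1 w'.1
  iseqv := ⟨fun w => .refl w.1, fun h => h.symm, fun h h' => h.trans h'⟩

/-- The set of normal forms of the elements of the graph product: reduced words up to shuffles. -/
abbrev NormalForm (Γ : SimpleGraph V) (M : V → Type v) [∀ α, Monoid (M α)] : Type (max u v) :=
  Quotient (shuffleSetoid Γ M)

namespace NormalForm

/-- Right multiplication of normal forms by an element of a vertex monoid. -/
noncomputable def push (α : V) (x : M α) : Function.End (NormalForm Γ M) :=
  Quotient.map (fun w => ⟨GraphProduct.push Γ α x w.1, w.2.push α x⟩)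
    fun _ _ h => Shuffle.push h α x

/-- The right action of the graph product on normal forms, written as a homomorphism to the
opposite of the monoid of self-maps. -/
noncomputable def act : GraphProduct Γ M →* (Function.End (NormalForm Γ M))ᵐᵒᵖ :=
  PresentedMonoid.lift (fun x : Σ α, M α => MulOpposite.op (push x.1 x.2)) <| by
    intro a b h
    apply MulOpposite.unop_injective
    funext w
    induction w using Quotient.inductionOn with
    | _ w =>
      obtain ⟨w, hw⟩ := w
      cases h with
      | one α =>
        refine Quotient.sound (?_ : Shuffle Γ _ _)
        simpa [GraphProduct.push] using hw.shuffle_consNe_split α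
      | mul x y =>
        exact congrArg (Quotient.mk _) (Subtype.ext (hw.push_push _ x y))
      | comm h x y => exact Quotient.sound (shuffle_push_comm h x y w)

/-- The final letter of vertex `α`, or `1` if there is none. -/
noncomputable def tail (α : V) : NormalForm Γ M → M α :=
  Quotient.lift (fun w => (split Γ α w.1).1) fun _ _ h => (split_shuffle α h).1

/-- The element of the graph product spelled by a word whose letters are listed in reverse. -/
def eval (Γ : SimpleGraph V) : List (Σ α, M α) → GraphProduct Γ M
  | [] => 1
  | x :: w => eval Γ w * of Γ x.1 x.2

theorem eval_shuffle {w w' : List (Σ α, M α)} (h : Shuffle Γ w w') : eval Γ w = eval Γ w' := by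
  induction h with
  | nil => rfl
  | cons x _ ih => rw [eval, eval, ih]
  | swap h w => simp only [eval, mul_assoc, of_comm h]
  | trans _ _ ih₁ ih₂ => exact ih₁.trans ih₂

theorem eval_consNe (α : V) (x : M α) (w : List (Σ α, M α)) :
    eval Γ (consNe α x w) = eval Γ w * of Γ α x := by
  by_cases hx : x = 1
  · simp [hx, consNe_one]
  · rw [consNe_of_ne hx, eval]

theorem eval_split {w : List (Σ α, M α)} (hw : Reduced Γ w) (α : V) :
    eval Γ (split Γ α w).2 * of Γ α (split Γ α w).1 = eval Γ w := by
  rw [← eval_consNe]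
  exact eval_shuffle (hw.shuffle_consNe_split α)

/-- The element of the graph product represented by a normal form with the final letter of vertex
`α` removed. -/
noncomputable def stem (α : V) : NormalForm Γ M → GraphProduct Γ M :=
  Quotient.lift (fun w => eval Γ (split Γ α w.1).2) fun _ _ h =>
    eval_shuffle (split_shuffle α h).2

/-- The element of the graph product represented by a normal form. -/
def toGraphProduct : NormalForm Γ M → GraphProduct Γ M :=
  Quotient.lift (fun w => eval Γ w.1) fun _ _ h => eval_shuffle h

theorem toGraphProduct_push (α : V) (x : M α) (w : NormalForm Γ M) :
    toGraphProduct (push α x w) = toGraphProduct w * of Γ α x := by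
  induction w using Quotient.inductionOn with
  | _ w =>
    change eval Γ (GraphProduct.push Γ α x w.1) = eval Γ w.1 * of Γ α x
    rw [GraphProduct.push, eval_consNe, map_mul, ← mul_assoc, eval_split w.2]

/-- The normal form of an element, obtained by letting it act on the empty word. -/
noncomputable def ofGraphProduct (g : GraphProduct Γ M) : NormalForm Γ M :=
  (act g).unop (Quotient.mk _ ⟨[], trivial⟩)

theorem ofGraphProduct_mul_of (g : GraphProduct Γ M) (α : V) (x : M α) :
    ofGraphProduct (g * of Γ α x) = push α x (ofGraphProduct g) := by
  simp only [ofGraphProduct, map_mul]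
  rfl

theorem toGraphProduct_ofGraphProduct (g : GraphProduct Γ M) :
    toGraphProduct (ofGraphProduct g) = g := by
  induction g using induction_on with
  | one => simp only [ofGraphProduct, map_one]; rfl
  | mul_of g α x ih => rw [ofGraphProduct_mul_of, toGraphProduct_push, ih]

theorem ofGraphProduct_eval {w : List (Σ α, M α)} (hw : Reduced Γ w) :
    ofGraphProduct (eval Γ w) = Quotient.mk _ ⟨w, hw⟩ := by
  induction w with
  | nil => simp only [ofGraphProduct, eval, map_one]; rfl
  | cons x w ih =>
    rw [eval, ofGraphProduct_mul_of, ih hw.2.2]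
    refine congrArg (Quotient.mk _) (Subtype.ext ?_)
    change GraphProduct.push Γ x.1 x.2 w = x :: w
    rw [GraphProduct.push, hw.2.2.split_eq hw.2.1, one_mul, consNe_of_ne hw.1]

end NormalForm

/-! ### Stems and tails of elements -/

/-- The component in `M α` that can be split off at the end of `g`. -/
noncomputable def tail (α : V) (g : GraphProduct Γ M) : M α :=
  (NormalForm.ofGraphProduct g).tail α

/-- What remains of `g` after splitting off its tail in `M α`. -/
noncomputable def stem (α : V) (g : GraphProduct Γ M) : GraphProduct Γ M :=
  (NormalForm.ofGraphProduct g).stem α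

theorem exists_reduced (g : GraphProduct Γ M) : ∃ w : List (Σ α, M α), ∃ hw : Reduced Γ w,
    NormalForm.ofGraphProduct g = Quotient.mk _ ⟨w, hw⟩ ∧ g = NormalForm.eval Γ w := by
  obtain ⟨⟨w, hw⟩, h⟩ := Quotient.exists_rep (NormalForm.ofGraphProduct g)
  refine ⟨w, hw, h.symm, ?_⟩
  rw [← NormalForm.toGraphProduct_ofGraphProduct g, ← h]
  rfl

theorem stem_mul_tail (α : V) (g : GraphProduct Γ M) : stem α g * of Γ α (tail α g) = g := by
  obtain ⟨w, hw, h, h'⟩ := exists_reduced g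
  rw [stem, tail, h]
  exact (NormalForm.eval_split hw α).trans h'.symm

theorem tail_mul_of (α : V) (g : GraphProduct Γ M) (x : M α) :
    tail α (g * of Γ α x) = tail α g * x := by
  obtain ⟨w, hw, h, -⟩ := exists_reduced g
  rw [tail, tail, NormalForm.ofGraphProduct_mul_of, h]
  exact congrArg Prod.fst (hw.split_push α x)

theorem stem_mul_of (α : V) (g : GraphProduct Γ M) (x : M α) :
    stem α (g * of Γ α x) = stem α g := by
  obtain ⟨w, hw, h, -⟩ := exists_reduced g
  rw [stem, stem, NormalForm.ofGraphProduct_mul_of, h]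
  exact congrArg (fun p => NormalForm.eval Γ p.2) (hw.split_push α x)

theorem tail_mul_of_adj {α β : V} (hβ : Γ.Adj α β) (g : GraphProduct Γ M) (x : M β) :
    tail α (g * of Γ β x) = tail α g := by
  obtain ⟨w, hw, h, -⟩ := exists_reduced g
  rw [tail, tail, NormalForm.ofGraphProduct_mul_of, h]
  change (split Γ α (push Γ β x w)).1 = (split Γ α w).1
  rw [push, split_consNe_adj hβ]
  exact (split_split hβ.symm w).1

theorem tail_eq_one_or {α β : V} (hne : β ≠ α) (hβ : ¬ Γ.Adj α β) (g : GraphProduct Γ M) :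
    tail α g = 1 ∨ tail β g = 1 := by
  obtain ⟨w, hw, h, -⟩ := exists_reduced g
  rw [tail, tail, h]
  exact hw.split_eq_one_or hne hβ

theorem tail_stem (α : V) (g : GraphProduct Γ M) : tail α (stem α g) = 1 := by
  obtain ⟨w, hw, h, -⟩ := exists_reduced g
  have h' : stem α g = NormalForm.eval Γ (split Γ α w).2 := by
    rw [stem, h]; rfl
  rw [h', tail, NormalForm.ofGraphProduct_eval (hw.split α).1]
  exact congrArg Prod.fst (hw.split α).2

theorem stem_eq_self {α : V} {g : GraphProduct Γ M} (h : tail α g = 1) : stem α g = g := by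
  simpa [h] using stem_mul_tail α g

theorem tail_one (α : V) : tail α (1 : GraphProduct Γ M) = 1 := by
  simp only [tail, NormalForm.ofGraphProduct, map_one]
  rfl

/-- A factorization of `g` whose left factor has trivial tail is the stem-tail factorization. -/
theorem stem_mul_of_eq {α : V} {u : GraphProduct Γ M} (h : tail α u = 1) (m : M α) :
    stem α (u * of Γ α m) = u := by
  rw [stem_mul_of, stem_eq_self h]

theorem tail_mul_of_eq {α : V} {u : GraphProduct Γ M} (h : tail α u = 1) (m : M α) :
    tail α (u * of Γ α m) = m := by
  rw [tail_mul_of, h, one_mul]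

theorem stem_mul_of_adj {α β : V} (hβ : Γ.Adj α β) (g : GraphProduct Γ M) (x : M β) :
    stem α (g * of Γ β x) = stem α g * of Γ β x := by
  have h : g * of Γ β x = stem α g * of Γ β x * of Γ α (tail α g) := by
    rw [mul_assoc, ← of_comm hβ, ← mul_assoc, stem_mul_tail]
  rw [h, stem_mul_of_eq]
  rw [tail_mul_of_adj hβ, tail_stem]

/-! ### Lengths and supports -/

/-- `SpelledIn S n g` says that `g` is a product of at most `n` letters with vertices in `S`. -/
inductive SpelledIn (S : Set V) : ℕ → GraphProduct Γ M → Prop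
  | one (n : ℕ) : SpelledIn S n 1
  | mul_of {n : ℕ} {g : GraphProduct Γ M} (h : SpelledIn S n g) {α : V} (hα : α ∈ S) (x : M α) :
      SpelledIn S (n + 1) (g * of Γ α x)

namespace SpelledIn

variable {S T : Set V} {m n : ℕ} {g h : GraphProduct Γ M}

theorem mono (hg : SpelledIn S m g) (hST : S ⊆ T) (hmn : m ≤ n) : SpelledIn T n g := by
  induction hg generalizing n with
  | one => exact .one n
  | mul_of _ hα x ih =>
    obtain ⟨n, rfl⟩ := Nat.exists_eq_add_of_le' (Nat.one_le_of_lt hmn)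
    exact .mul_of (ih (by omega)) (hST hα) x

theorem mul (hg : SpelledIn S m g) (hh : SpelledIn S n h) : SpelledIn S (m + n) (g * h) := by
  induction hh with
  | one k => simpa using hg.mono subset_rfl (Nat.le_add_right m k)
  | mul_of _ hα x ih =>
    rw [← mul_assoc]
    exact ih.mul_of hα x

theorem exists_univ (g : GraphProduct Γ M) : ∃ n, SpelledIn Set.univ n g := by
  induction g using induction_on with
  | one => exact ⟨0, .one 0⟩
  | mul_of g α x ih =>
    obtain ⟨n, hn⟩ := ih
    exact ⟨n + 1, hn.mul_of (Set.mem_univ α) x⟩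

theorem stem (hg : SpelledIn S n g) (α : V) : SpelledIn S n (stem α g) := by
  induction n using Nat.strong_induction_on generalizing g α with
  | _ n ih =>
    cases hg with
    | one => simpa [stem_eq_self (tail_one α)] using SpelledIn.one n
    | @mul_of n g hg β hβ x =>
      have hs := ih n (Nat.lt_succ_self n) hg β
      have hfac : g * of Γ β x = GraphProduct.stem β g * of Γ β (tail β g * x) := by
        rw [map_mul, ← mul_assoc, stem_mul_tail]
      rw [hfac]
      -- If the last letter is absorbed, the product is already spelled by `n` letters; otherwise
      -- it stays at the end, and blocks the letters of vertex `α` unless `β` is adjacent to `α`.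
      by_cases hx : tail β g * x = 1
      · rw [hx, map_one, mul_one]
        exact (ih n (Nat.lt_succ_self n) hs α).mono subset_rfl (Nat.le_succ n)
      · rcases eq_or_adj_or Γ α β with rfl | hαβ | ⟨hne, hαβ⟩
        · rw [stem_mul_of, stem_eq_self (tail_stem _ _)]
          exact hs.mono subset_rfl (Nat.le_succ n)
        · rw [stem_mul_of_adj hαβ]
          exact (ih n (Nat.lt_succ_self n) hs α).mul_of hβ _
        · rw [stem_eq_self]
          · exact hs.mul_of hβ _
          · refine (tail_eq_one_or hne hαβ _).resolve_right ?_
            rwa [tail_mul_of_eq (tail_stem _ _)]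

/-- Letters of vertices adjacent to `α` commute with `M α`. -/
theorem comm {α : V} (hc : SpelledIn (Γ.neighborSet α) n g) (x : M α) :
    g * of Γ α x = of Γ α x * g := by
  induction hc with
  | one => simp
  | mul_of _ hβ y ih =>
    rw [mul_assoc, ← of_comm hβ, ← mul_assoc, ih, mul_assoc]

theorem tail_mul {α : V} (hc : SpelledIn (Γ.neighborSet α) n g) (h : GraphProduct Γ M) :
    tail α (h * g) = tail α h := by
  induction hc with
  | one => simp
  | mul_of _ hβ y ih =>
    rw [← mul_assoc, tail_mul_of_adj hβ, ih]

theorem stem_mul {α : V} (hc : SpelledIn (Γ.neighborSet α) n g) (h : GraphProduct Γ M) :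
    GraphProduct.stem α (h * g) = GraphProduct.stem α h * g := by
  induction hc with
  | one => simp
  | mul_of _ hβ y ih =>
    rw [← mul_assoc, stem_mul_of_adj hβ, ih, mul_assoc]

/-- Either every letter of `g` has vertex `α` or a vertex adjacent to `α`, or `g` can be cut at its
last letter which is not of this kind. -/
theorem star_or_blocked (hg : SpelledIn S n g) (α : V) :
    (∃ c k, SpelledIn (S ∩ Γ.neighborSet α) n c ∧ g = c * of Γ α k) ∨
      ∃ p q, p + q + 1 ≤ n ∧ ∃ β, β ≠ α ∧ ¬ Γ.Adj α β ∧ ∃ (u : GraphProduct Γ M) (y : M β)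
        (c : GraphProduct Γ M) (k : M α), SpelledIn S p u ∧
          SpelledIn (S ∩ Γ.neighborSet α) q c ∧ g = u * of Γ β y * c * of Γ α k := by
  induction hg with
  | one n => exact .inl ⟨1, 1, .one n, by simp⟩
  | @mul_of n g hg γ hγ x ih =>
    rcases eq_or_adj_or Γ α γ with rfl | hαγ | ⟨hne, hαγ⟩
    · rcases ih with ⟨c, k, hc, rfl⟩ | ⟨p, q, hpq, β, hne, hβ, u, y, c, k, hu, hc, rfl⟩
      · exact .inl ⟨c, k * x, hc.mono subset_rfl (Nat.le_succ n), by rw [map_mul, mul_assoc]⟩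
      · exact .inr ⟨p, q, by omega, β, hne, hβ, u, y, c, k * x, hu, hc,
          by rw [map_mul, ← mul_assoc]⟩
    · rcases ih with ⟨c, k, hc, rfl⟩ | ⟨p, q, hpq, β, hne, hβ, u, y, c, k, hu, hc, rfl⟩
      · exact .inl ⟨c * of Γ γ x, k, hc.mul_of ⟨hγ, hαγ⟩ x, by
          rw [mul_assoc, mul_assoc, of_comm hαγ]⟩
      · exact .inr ⟨p, q + 1, by omega, β, hne, hβ, u, y, c * of Γ γ x, k, hu,
          hc.mul_of ⟨hγ, hαγ⟩ x, by simp only [mul_assoc, of_comm hαγ]⟩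
    · exact .inr ⟨n, 0, by omega, γ, hne, hαγ, g, x, 1, 1, hg, .one 0, by simp⟩

end SpelledIn

/-! ### Left ideals and final letters -/

/-- `a` and `b` generate the same principal left ideal. -/
def LeftAssociated {G : Type*} [Monoid G] (a b : G) : Prop :=
  (∃ p, a = p * b) ∧ ∃ q, b = q * a

namespace LeftAssociated

variable {G : Type*} [Monoid G] {a b c : G}

theorem refl (a : G) : LeftAssociated a a :=
  ⟨⟨1, (one_mul a).symm⟩, 1, (one_mul a).symm⟩

theorem trans (h : LeftAssociated a b) (h' : LeftAssociated b c) : LeftAssociated a c := by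
  obtain ⟨⟨p, rfl⟩, q, hq⟩ := h
  obtain ⟨⟨p', rfl⟩, q', hq'⟩ := h'
  exact ⟨⟨p * p', by rw [mul_assoc]⟩, q' * q, by rw [mul_assoc, ← hq, ← hq']⟩

theorem mul_right (h : LeftAssociated a b) (c : G) : LeftAssociated (a * c) (b * c) := by
  obtain ⟨⟨p, hp⟩, q, hq⟩ := h
  exact ⟨⟨p, by rw [hp, mul_assoc]⟩, q, by rw [← mul_assoc, ← hq]⟩

theorem exists_eq_mul_iff (h : LeftAssociated a b) (w : G) :
    (∃ s, w = s * a) ↔ ∃ s, w = s * b := by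
  obtain ⟨⟨p, hp⟩, q, hq⟩ := h
  constructor
  · rintro ⟨s, rfl⟩
    exact ⟨s * p, by rw [mul_assoc, ← hp]⟩
  · rintro ⟨s, rfl⟩
    exact ⟨s * q, by rw [mul_assoc, ← hq]⟩

end LeftAssociated

/-- No left multiple of `u` has a nontrivial tail in `M α`. -/
def Rigid (α : V) (u : GraphProduct Γ M) : Prop :=
  ∀ s, tail α (s * u) = 1

theorem Rigid.tail_eq_one {α : V} {u : GraphProduct Γ M} (hu : Rigid α u) : tail α u = 1 := by
  simpa using hu 1

theorem Rigid.mul_left {α : V} {u : GraphProduct Γ M} (hu : Rigid α u) (p : GraphProduct Γ M) :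
    Rigid α (p * u) := fun s => by
  rw [← mul_assoc]
  exact hu (s * p)

/-- Up to left invertible factors, the left ideal generated by `a` either consists of elements with
the same tail in `M α`, or is generated by an element all of whose letters have vertex `α` or a
vertex adjacent to `α`. -/
theorem rigid_or_star {S : Set V} {n : ℕ} {a : GraphProduct Γ M} (ha : SpelledIn S n a) (α : V) :
    (∃ u m, a = u * of Γ α m ∧ Rigid α u) ∨
      ∃ c k, SpelledIn (S ∩ Γ.neighborSet α) n c ∧ LeftAssociated a (c * of Γ α k) := by
  induction n using Nat.strong_induction_on generalizing a α with
  | _ n ih =>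
    rcases ha.star_or_blocked α with ⟨c, k, hc, rfl⟩ |
      ⟨p, q, hpq, β, hne, hβ, u, y, c, k, hu, hc, rfl⟩
    · exact .inr ⟨c, k, hc, .refl _⟩
    -- It suffices to replace `a` by a left associated shorter element, up to a factor in `M α`.
    have reduce : ∀ b : GraphProduct Γ M, SpelledIn S (p + q) b →
        LeftAssociated (u * of Γ β y * c * of Γ α k) (b * of Γ α k) →
        (∃ v m, u * of Γ β y * c * of Γ α k = v * of Γ α m ∧ Rigid α v) ∨
          ∃ d l, SpelledIn (S ∩ Γ.neighborSet α) n d ∧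
            LeftAssociated (u * of Γ β y * c * of Γ α k) (d * of Γ α l) := by
      intro b hb hab
      rcases ih (p + q) (by omega) hb α with ⟨v, m, rfl, hv⟩ | ⟨d, l, hd, hbd⟩
      · obtain ⟨⟨r, hr⟩, -⟩ := hab
        exact .inl ⟨r * v, m * k, by rw [hr, map_mul]; simp only [mul_assoc], hv.mul_left r⟩
      · refine .inr ⟨d, l * k, hd.mono subset_rfl (by omega), ?_⟩
        rw [map_mul, ← mul_assoc]
        exact hab.trans (hbd.mul_right _)
    have hcα := hc.mono Set.inter_subset_right le_rfl
    have hcS := hc.mono Set.inter_subset_left le_rfl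
    -- Collect the last letter `z` of vertex `β` that precedes `c`.
    obtain ⟨v, hv, hvβ, z, hz⟩ : ∃ v, SpelledIn S p v ∧ tail β v = 1 ∧ ∃ z : M β,
        u * of Γ β y = v * of Γ β z :=
      ⟨stem β u, hu.stem β, tail_stem β u, tail β u * y, by
        rw [map_mul, ← mul_assoc, stem_mul_tail]⟩
    rw [hz] at reduce ⊢
    by_cases hz1 : z = 1
    · subst hz1
      rw [map_one, mul_one] at reduce ⊢
      exact reduce (v * c) (hv.mul hcS) (.refl _)
    by_cases hrig : Rigid α (v * of Γ β z * c)
    · exact .inl ⟨_, k, rfl, hrig⟩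
    obtain ⟨s, hs⟩ := not_forall.mp hrig
    -- The left factor `s` exposes a letter of vertex `α`, hence it cancels `z`.
    rw [← mul_assoc, hcα.tail_mul] at hs
    have hsz : tail β (s * v) * z = 1 := by
      rw [← tail_mul_of, mul_assoc]
      exact (tail_eq_one_or hne hβ _).resolve_left hs
    rcases ih p (by omega) hv β with ⟨v', m, hvv, hrig'⟩ | ⟨d, l, hd, ⟨P, hP⟩, Q, hQ⟩
    · -- This alternative would give `tail β (s * v) = 1`.
      exfalso
      have hm : m = 1 := by rw [← hvβ, hvv, tail_mul_of_eq hrig'.tail_eq_one]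
      rw [hvv, hm, map_one, mul_one, hrig' s, one_mul] at hsz
      exact hz1 hsz
    have hdβ := hd.mono Set.inter_subset_right le_rfl
    have hdS := hd.mono Set.inter_subset_left le_rfl
    have hlz : tail β (s * P) * l * z = 1 := by
      rw [← hsz, hP, ← mul_assoc, ← mul_assoc, tail_mul_of, hdβ.tail_mul]
    generalize tail β (s * P) = h at hlz
    -- Since `l * z` is left invertible, it can be dropped after moving it to the front.
    refine reduce (d * c) (hdS.mul hcS) (LeftAssociated.mul_right ⟨⟨P * of Γ β (l * z), ?_⟩,
      of Γ β h * Q, ?_⟩ _)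
    · rw [hP, map_mul]
      calc P * (d * of Γ β l) * of Γ β z * c = P * (d * of Γ β l * of Γ β z) * c := by
            simp only [mul_assoc]
        _ = P * (of Γ β l * of Γ β z * d) * c := by
            rw [mul_assoc d, ← map_mul, hdβ.comm]
        _ = _ := by simp only [mul_assoc]
    · symm
      calc of Γ β h * Q * (v * of Γ β z * c) = of Γ β h * (Q * v) * of Γ β z * c := by
            simp only [mul_assoc]
        _ = of Γ β h * d * of Γ β l * of Γ β z * c := by
            rw [← hQ]; simp only [mul_assoc]
        _ = d * of Γ β (h * l * z) * c := by
            rw [← hdβ.comm, map_mul, map_mul]; simp only [mul_assoc]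
        _ = d * c := by rw [hlz, map_one, mul_one]

/-! ### Intersections of principal left ideals -/

/-- The set of left multiples of elements of `Y`. -/
def leftMultiples {G : Type*} [Monoid G] (Y : Set G) : Set G :=
  {w | ∃ s, ∃ y ∈ Y, w = s * y}

/-- The intersection of the left ideals generated by `a` and `b` is generated by a finite set of
products of letters with vertices in `S`. -/
def FinitelyIntersecting (S : Set V) (a b : GraphProduct Γ M) : Prop :=
  ∃ Y : Set (GraphProduct Γ M), Y.Finite ∧ (∀ y ∈ Y, ∃ n, SpelledIn S n y) ∧
    ∀ w, ((∃ s, w = s * a) ∧ ∃ t, w = t * b) ↔ w ∈ leftMultiples Y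

namespace FinitelyIntersecting

variable {S : Set V} {a a' b b' : GraphProduct Γ M}

theorem symm (h : FinitelyIntersecting S a b) : FinitelyIntersecting S b a := by
  obtain ⟨Y, hY, hYS, h⟩ := h
  exact ⟨Y, hY, hYS, fun w => and_comm.trans (h w)⟩

theorem congr (ha : LeftAssociated a a') (hb : LeftAssociated b b')
    (h : FinitelyIntersecting S a' b') : FinitelyIntersecting S a b := by
  obtain ⟨Y, hY, hYS, h⟩ := h
  refine ⟨Y, hY, hYS, fun w => ?_⟩
  rw [ha.exists_eq_mul_iff, hb.exists_eq_mul_iff]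
  exact h w

theorem one_left {n : ℕ} (hb : SpelledIn S n b) : FinitelyIntersecting S 1 b := by
  refine ⟨{b}, Set.finite_singleton b, by simpa using ⟨n, hb⟩, fun w => ?_⟩
  simp [leftMultiples]

theorem of_disjoint (h : ∀ s t, s * a ≠ t * b) : FinitelyIntersecting S a b := by
  refine ⟨∅, Set.finite_empty, by simp, fun w => ?_⟩
  simp only [leftMultiples, Set.mem_empty_iff_false, false_and, exists_false, Set.mem_ofPred_eq,
    iff_false]
  rintro ⟨⟨s, rfl⟩, t, ht⟩
  exact h s t ht

/-- If common left multiples of `u * of Γ α m` and `b` are exactly the products `x * of Γ α m`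
with `x` a common left multiple of `u` and `v`, then generators may be multiplied by `m`. -/
theorem mul_of {α : V} (hα : α ∈ S) {u v : GraphProduct Γ M} (m : M α)
    (h : FinitelyIntersecting S u v)
    (h₁ : ∀ s t, s * (u * of Γ α m) = t * b → ∃ t', s * u = t' * v)
    (h₂ : ∀ s t, s * u = t * v → ∃ t', s * (u * of Γ α m) = t' * b) :
    FinitelyIntersecting S (u * of Γ α m) b := by
  obtain ⟨Y, hY, hYS, h⟩ := h
  refine ⟨(· * of Γ α m) '' Y, hY.image _, ?_, fun w => ⟨?_, ?_⟩⟩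
  · rintro _ ⟨y, hy, rfl⟩
    obtain ⟨n, hn⟩ := hYS y hy
    exact ⟨n + 1, hn.mul_of hα m⟩
  · rintro ⟨⟨s, rfl⟩, t, ht⟩
    obtain ⟨r, y, hy, hr⟩ := (h _).1 ⟨⟨s, rfl⟩, h₁ s t ht⟩
    exact ⟨r, _, ⟨y, hy, rfl⟩, by rw [← mul_assoc, hr, mul_assoc]⟩
  · rintro ⟨r, _, ⟨y, hy, rfl⟩, rfl⟩
    obtain ⟨⟨s, hs⟩, t, ht⟩ := (h (r * y)).2 ⟨r, y, hy, rfl⟩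
    obtain ⟨t', ht'⟩ := h₂ s t (hs.symm.trans ht)
    have hw : r * (y * of Γ α m) = s * (u * of Γ α m) := by rw [← mul_assoc, hs, mul_assoc]
    exact ⟨⟨s, hw⟩, t', hw.trans ht'⟩

theorem of_rigid_rigid {α : V} (hα : α ∈ S) {u v : GraphProduct Γ M} (hu : Rigid α u)
    (hv : Rigid α v) (m n : M α) (h : FinitelyIntersecting S u v) :
    FinitelyIntersecting S (u * of Γ α m) (v * of Γ α n) := by
  have key : ∀ s t, s * (u * of Γ α m) = t * (v * of Γ α n) → s * u = t * v ∧ m = n := by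
    intro s t hst
    rw [← mul_assoc, ← mul_assoc] at hst
    refine ⟨?_, ?_⟩
    · rw [← stem_mul_of_eq (hu s) m, hst, stem_mul_of_eq (hv t)]
    · rw [← tail_mul_of_eq (hu s) m, hst, tail_mul_of_eq (hv t)]
  by_cases hmn : m = n
  · subst hmn
    exact h.mul_of hα m (fun s t hst => ⟨t, (key s t hst).1⟩)
      fun s t hst => ⟨t, by rw [← mul_assoc, hst, mul_assoc]⟩
  · exact of_disjoint fun s t hst => hmn (key s t hst).2

theorem of_rigid_star {α : V} (hα : α ∈ S) {u v : GraphProduct Γ M} (hu : Rigid α u) {q : ℕ}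
    (hv : SpelledIn (Γ.neighborSet α) q v) (m n : M α) (h : FinitelyIntersecting S u v) :
    FinitelyIntersecting S (u * of Γ α m) (v * of Γ α n) := by
  have key : ∀ s t, s * (u * of Γ α m) = t * (v * of Γ α n) →
      s * u = stem α t * v ∧ m = tail α t * n := by
    intro s t hst
    rw [← mul_assoc, ← mul_assoc] at hst
    refine ⟨?_, ?_⟩
    · rw [← stem_mul_of_eq (hu s) m, hst, stem_mul_of, hv.stem_mul]
    · rw [← tail_mul_of_eq (hu s) m, hst, tail_mul_of, hv.tail_mul]
  by_cases hmn : ∃ k, m = k * n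
  · obtain ⟨k, rfl⟩ := hmn
    refine h.mul_of hα _ (fun s t hst => ⟨_, (key s t hst).1⟩) fun s t hst => ⟨t * of Γ α k, ?_⟩
    rw [← mul_assoc, hst, map_mul, mul_assoc, ← mul_assoc v, hv.comm]
    simp only [mul_assoc]
  · exact of_disjoint fun s t hst => hmn ⟨_, (key s t hst).2⟩

theorem of_star_star {α : V} (hα : α ∈ S) (hM : IsLeftIdealHowson (M α))
    {u v : GraphProduct Γ M} {p q : ℕ} (hu : SpelledIn (Γ.neighborSet α) p u)
    (hv : SpelledIn (Γ.neighborSet α) q v) (m n : M α)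
    (h : FinitelyIntersecting (S ∩ Γ.neighborSet α) u v) :
    FinitelyIntersecting S (u * of Γ α m) (v * of Γ α n) := by
  obtain ⟨Y, hY, hYS, h⟩ := h
  obtain ⟨Z, hZ, hmn⟩ := (isLeftIdealHowson_iff_principal (M α)).1 hM m n
  have hcomm : ∀ y ∈ Y, ∀ x : M α, y * of Γ α x = of Γ α x * y := by
    intro y hy x
    obtain ⟨l, hl⟩ := hYS y hy
    exact (hl.mono Set.inter_subset_right le_rfl).comm x
  refine ⟨Set.image2 (fun y z => y * of Γ α z) Y Z, hY.image2 _ hZ, ?_, fun w => ⟨?_, ?_⟩⟩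
  · rintro _ ⟨y, hy, z, -, rfl⟩
    obtain ⟨l, hl⟩ := hYS y hy
    exact ⟨l + 1, (hl.mono Set.inter_subset_left le_rfl).mul_of hα z⟩
  · rintro ⟨⟨s, hs⟩, t, ht⟩
    rw [← mul_assoc] at hs ht
    obtain ⟨g, y, hy, hg⟩ := (h (stem α w)).1
      ⟨⟨stem α s, by rw [hs, stem_mul_of, hu.stem_mul]⟩,
        stem α t, by rw [ht, stem_mul_of, hv.stem_mul]⟩
    obtain ⟨r, z, hz, hr⟩ := (Set.ext_iff.1 hmn (tail α w)).1
      ⟨⟨tail α s, by rw [hs, tail_mul_of, hu.tail_mul]⟩,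
        tail α t, by rw [ht, tail_mul_of, hv.tail_mul]⟩
    refine ⟨g * of Γ α r, _, ⟨y, hy, z, hz, rfl⟩, ?_⟩
    rw [← stem_mul_tail α w, hg, hr, map_mul, mul_assoc, ← mul_assoc y, hcomm y hy]
    simp only [mul_assoc]
  · rintro ⟨g, _, ⟨y, hy, z, hz, rfl⟩, rfl⟩
    obtain ⟨⟨s, hs⟩, t, ht⟩ := (h y).2 ⟨1, y, hy, (one_mul y).symm⟩
    obtain ⟨⟨i, hi⟩, j, hj⟩ := (Set.ext_iff.1 hmn z).2 ⟨1, z, hz, (one_mul z).symm⟩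
    refine ⟨⟨g * s * of Γ α i, ?_⟩, g * t * of Γ α j, ?_⟩
    · dsimp only
      rw [hi, hs, map_mul, mul_assoc s, ← mul_assoc u, hu.comm]
      simp only [mul_assoc]
    · dsimp only
      rw [hj, ht, map_mul, mul_assoc t, ← mul_assoc v, hv.comm]
      simp only [mul_assoc]

end FinitelyIntersecting

/-- The two alternatives of `rigid_or_star`, with control of the length of the left factor. -/
theorem exists_rigid_or_star {S : Set V} {n : ℕ} {a : GraphProduct Γ M} (ha : SpelledIn S n a)
    (α : V) : ∃ u m, LeftAssociated a (u * of Γ α m) ∧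
      (Rigid α u ∧ SpelledIn S n u ∨ SpelledIn (S ∩ Γ.neighborSet α) n u) := by
  rcases rigid_or_star ha α with ⟨u, m, rfl, hu⟩ | ⟨c, k, hc, h⟩
  · refine ⟨u, m, .refl _, .inl ⟨hu, ?_⟩⟩
    rw [← stem_mul_of_eq hu.tail_eq_one m]
    exact ha.stem α
  · exact ⟨c, k, h, .inr hc⟩

theorem finitelyIntersecting (hM : ∀ α, IsLeftIdealHowson (M α)) {S : Set V} {p q : ℕ}
    {a b : GraphProduct Γ M} (ha : SpelledIn S p a) (hb : SpelledIn S q b) :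
    FinitelyIntersecting S a b := by
  induction p using Nat.strong_induction_on generalizing S q a b with
  | _ p ih =>
    cases ha with
    | one => exact .one_left hb
    | @mul_of p a ha α hα x =>
      obtain ⟨u, m, hau, hu⟩ := exists_rigid_or_star ha α
      obtain ⟨v, n, hbv, hv⟩ := exists_rigid_or_star hb α
      refine .congr ((hau.mul_right (of Γ α x)).trans ?_) hbv
        (?_ : FinitelyIntersecting S (u * of Γ α (m * x)) (v * of Γ α n))
      · rw [map_mul, ← mul_assoc]
        exact .refl _
      have hp := Nat.lt_succ_self p
      rcases hu with ⟨hu, hu'⟩ | hu <;> rcases hv with ⟨hv, hv'⟩ | hv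
      · exact .of_rigid_rigid hα hu hv _ _ (ih p hp hu' hv')
      · exact .of_rigid_star hα hu (hv.mono Set.inter_subset_right le_rfl) _ _
          (ih p hp hu' (hv.mono Set.inter_subset_left le_rfl))
      · exact (FinitelyIntersecting.of_rigid_star hα hv (hu.mono Set.inter_subset_right le_rfl) _ _
          (ih p hp (hu.mono Set.inter_subset_left le_rfl) hv').symm).symm
      · exact .of_star_star hα (hM α) (hu.mono Set.inter_subset_right le_rfl)
          (hv.mono Set.inter_subset_right le_rfl) _ _ (ih p hp hu hv)

/-! ### Vertex monoids as retracts -/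

open Classical in
/-- The retraction of the graph product onto the vertex monoid `M α`, which kills the letters of
all other vertices. -/
noncomputable def retract (Γ : SimpleGraph V) (M : V → Type v) [∀ α, Monoid (M α)] (α : V) :
    GraphProduct Γ M →* M α :=
  PresentedMonoid.lift (fun x : Σ β, M β => Pi.mulSingle x.1 x.2 α) <| by
    intro a b h
    cases h with
    | one β => simp
    | @mul β x y => simp [Pi.mulSingle_mul]
    | @comm β γ h x y => simpa using congrFun (Pi.mulSingle_commute h.ne x y).eq α

theorem retract_of (α : V) (x : M α) : retract Γ M α (of Γ α x) = x := by
  classical exact Pi.mulSingle_eq_same α x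

end GraphProduct

/-- The left ideal Howson property passes to retracts. -/
theorem IsLeftIdealHowson.of_leftInverse {G : Type*} {N : Type*} [Monoid G] [Monoid N]
    (hG : IsLeftIdealHowson G) (i : N →* G) (r : G →* N) (h : Function.LeftInverse r i) :
    IsLeftIdealHowson N := by
  rw [isLeftIdealHowson_iff_principal] at hG ⊢
  intro a b
  obtain ⟨Y, hY, hab⟩ := hG (i a) (i b)
  refine ⟨r '' Y, hY.image r, Set.ext fun z => ⟨?_, ?_⟩⟩
  · rintro ⟨⟨s, hs⟩, t, ht⟩
    obtain ⟨g, y, hy, hz⟩ := (Set.ext_iff.1 hab (i z)).1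
      ⟨⟨i s, by rw [hs, map_mul]⟩, i t, by rw [ht, map_mul]⟩
    exact ⟨r g, r y, ⟨y, hy, rfl⟩, by rw [← map_mul, ← hz, h z]⟩
  · rintro ⟨g, _, ⟨y, hy, rfl⟩, rfl⟩
    obtain ⟨⟨s, hs⟩, t, ht⟩ := (Set.ext_iff.1 hab y).2 ⟨1, y, hy, (one_mul y).symm⟩
    refine ⟨⟨g * r s, ?_⟩, g * r t, ?_⟩
    · rw [hs, map_mul, h a, mul_assoc]
    · rw [ht, map_mul, h b, mul_assoc]

theorem theorem5p1 {V : Type u} (Γ : SimpleGraph V) (M : V → Type v) [∀ α, Monoid (M α)] :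
    IsLeftIdealHowson (GraphProduct Γ M) ↔ ∀ α : V, IsLeftIdealHowson (M α) := by
  constructor
  · exact fun h α => h.of_leftInverse (GraphProduct.of Γ α) (GraphProduct.retract Γ M α)
      (GraphProduct.retract_of α)
  · intro hM
    rw [isLeftIdealHowson_iff_principal]
    intro a b
    obtain ⟨p, ha⟩ := GraphProduct.SpelledIn.exists_univ a
    obtain ⟨q, hb⟩ := GraphProduct.SpelledIn.exists_univ b
    obtain ⟨Y, hY, -, h⟩ := GraphProduct.finitelyIntersecting hM ha hb
    exact ⟨Y, hY, Set.ext h⟩
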